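/- **Theorem (Denotational model for xPTCL).** *Types and syntax.* Let $\mathsf{Ty}$ be the set of simple types $\tau ::= \mathsf{unit} \mid \tau\to\tau$, and let $\mathbf{Set}^{\mathsf{Ty}}$ be the category of $\mathsf{Ty}$-sorted sets. Let $\Sigma^{\mathsf p}$ be the polynomial endofunctor of $\mathbf{Set}^{\mathsf{Ty}}$ given by the signature with operations, for all types $\tau,\tau_i$, $$\mathsf e:\mathsf{unit},\quad \mathsf{app}:(\tau_1\to\tau_2)\times\tau_1\to\tau_2,\quad I:\tau\to\tau,\quad K:\tau_1\to\tau_2\to\tau_1,\quad K':\tau_1\Rightarrow(\tau_2\to\tau_1),$$ $$S:(\tau_1\to\tau_2\to\tau_3)\to(\tau_1\to\tau_2)\to\tau_1\to\tau_3,\quad S':(\tau_1\to\tau_2\to\tau_3)\Rightarrow((\tau_1\to\tau_2)\to\tau_1\to\tau_3),$$ $$S'':(\tau_1\to\tau_2\to\tau_3)\times(\tau_1\to\tau_2)\Rightarrow(\tau_1\to\tau_3),\quad \oplus:\tau\times\tau\Rightarrow\tau$$ ($\mathsf e,I,K,S$ are constants, $\Rightarrow$ separates argument sorts from the result sort, and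 $p\,q$ abbreviates $\mathsf{app}(p,q)$). Let $\Sigma^{\mathsf p\star}$ be the free (term) monad and $\mu\Sigma^{\mathsf p}$ the initial algebra of closed terms (programs). *Behaviour.* Let $\mathcal D_\omega X$ be the set of finitely supported probability distributions on $X$, and let $B^{\mathsf p}:(\mathbf{Set}^{\mathsf{Ty}})^{\mathrm{op}}\times\mathbf{Set}^{\mathsf{Ty}}\to\mathbf{Set}^{\mathsf{Ty}}$ be the bifunctor $$B^{\mathsf p}_{\mathsf{unit}}(X,Y)=\mathcal D_\omega(Y_{\mathsf{unit}})+1,\qquad B^{\mathsf p}_{\tau_1\to\tau_2}(X,Y)=\mathcal D_\omega(Y_{\tau_1\to\tau_2})+Y_{\tau_2}^{X_{\tau_1}}.$$ A higher-order coalgebra is a map $c:C\to B^{\mathsf p}(C,C)$; a morphism $h:(C,c)\to(D,d)$ is a map $h:C\to D$ with $B^{\mathsf p}(\mathrm{id},h)\cdot c=B^{\mathsf p}(h,\mathrm{id})\cdot d\cdot h$. A higher-order coalgebra $z:Z\to B^{\mathsf p}(Z,Z)$ is *locally final* if it is a final coalgebra for the endofunctor $B^{\mathsf p}(Z,-)$.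 *Operational semantics.* Let $\rho^{\mathsf p}_{X,Y}:\Sigma^{\mathsf p}(X\times B^{\mathsf p}(X,Y))\to B^{\mathsf p}(X,\Sigma^{\mathsf p\star}(X+Y))$ (dinatural in $X$, natural in $Y$) be the higher-order GSOS law given, with coproduct injections and variables left implicit, by $$\mathsf e\mapsto *,\quad S\mapsto\lambda t.\,S'(t),\quad S'(p,\_)\mapsto\lambda t.\,S''(p,t),\quad S''((p,\_),(q,\_))\mapsto\lambda t.\,(p\,t)(q\,t),$$ $$K\mapsto\lambda t.\,K'(t),\quad K'(p,\_)\mapsto\lambda t.\,p,\quad I\mapsto\lambda t.\,t,\quad (p,\_)\oplus(q,\_)\mapsto \tfrac12\cdot p+\tfrac12\cdot q,$$ $$\mathsf{app}((p,\textstyle\sum_i r_i\cdot p_i),(q,\_))\mapsto\textstyle\sum_i r_i\cdot(p_i\,q),\qquad \mathsf{app}((p,f),(q,\_))\mapsto 1\cdot f(q).$$ A *$\rho^{\mathsf p}$-bialgebra* is an object $X$ with maps $\Sigma^{\mathsf p}X\xrightarrow{a}X\xrightarrow{c}B^{\mathsf p}(X,X)$ such that $c\cdot a=B^{\mathsf p}(\mathrm{id},\hat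 a\cdot\Sigma^{\mathsf p\star}\nabla)\cdot\rho^{\mathsf p}_{X,X}\cdot\Sigma^{\mathsf p}\langle\mathrm{id},c\rangle$, where $\hat a:\Sigma^{\mathsf p\star}X\to X$ evaluates terms in $(X,a)$ and $\nabla:X+X\to X$ is the codiagonal. The *operational model* $\gamma^{\mathsf p}:\mu\Sigma^{\mathsf p}\to B^{\mathsf p}(\mu\Sigma^{\mathsf p},\mu\Sigma^{\mathsf p})$ is the unique map making $\mu\Sigma^{\mathsf p}$, with its initial algebra structure, a $\rho^{\mathsf p}$-bialgebra. A *denotational model* is a $\rho^{\mathsf p}$-bialgebra whose underlying higher-order coalgebra is locally final. *Bisimilarity.* A $\mathsf{Ty}$-indexed equivalence relation $R$ on $\mu\Sigma^{\mathsf p}$ is a *strong probabilistic applicative bisimulation* if for all $p\mathrel{R_\tau}q$ one of the following holds: (1) $\gamma^{\mathsf p}(p),\gamma^{\mathsf p}(q)\in\mathcal D_\omega(\mu\Sigma^{\mathsf p}_\tau)$ and $\sum_{t\in E}\gamma^{\mathsf p}(p)(t)=\sum_{t\in E}\gamma^{\mathsf p}(q)(t)$ for every equivalence class $E$ of $R_\tau$;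 (2) $\tau=\mathsf{unit}$ and $\gamma^{\mathsf p}(p)=\gamma^{\mathsf p}(q)=*$; (3) $\tau=\tau_1\to\tau_2$, both $\gamma^{\mathsf p}(p)$ and $\gamma^{\mathsf p}(q)$ are functions $\mu\Sigma^{\mathsf p}_{\tau_1}\to\mu\Sigma^{\mathsf p}_{\tau_2}$, and $\gamma^{\mathsf p}(p)(t)\mathrel{R_{\tau_2}}\gamma^{\mathsf p}(q)(t)$ for every $t\in\mu\Sigma^{\mathsf p}_{\tau_1}$. Let *strong probabilistic applicative bisimilarity* $\sim^{\mathsf p}$ be the join of all such relations in the lattice of $\mathsf{Ty}$-indexed equivalence relations. Then: 1. $B^{\mathsf p}$ has a locally final coalgebra, and any two locally final coalgebras for $B^{\mathsf p}$ are isomorphic as higher-order coalgebras. 2. The relation $\sim^{\mathsf p}$ is itself a strong probabilistic applicative bisimulation, hence the greatest one, and it is behavioural equivalence on $(\mu\Sigma^{\mathsf p},\gamma^{\mathsf p})$: $p\sim^{\mathsf p}_\tau q$ if and only if $\mathsf{beh}_\tau(p)=\mathsf{beh}_\tau(q)$, where $\mathsf{beh}$ is the unique $B^{\mathsf p}(\mu\Sigma^{\mathsf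 p},-)$-coalgebra morphism from $(\mu\Sigma^{\mathsf p},\gamma^{\mathsf p})$ to a final coalgebra for $B^{\mathsf p}(\mu\Sigma^{\mathsf p},-)$. 3. Every locally final coalgebra $(Z,z)$ extends, by some algebra structure $a:\Sigma^{\mathsf p}Z\to Z$, to a denotational model $(Z,a,z)$ that is adequate: the final coalgebra $\nu B^{\mathsf p}(\mu\Sigma^{\mathsf p},-)$ exists, the map $\mathsf{beh}:\mu\Sigma^{\mathsf p}\to\nu B^{\mathsf p}(\mu\Sigma^{\mathsf p},-)$ factorizes through the unique $\Sigma^{\mathsf p}$-algebra morphism $[\![-]\!]:\mu\Sigma^{\mathsf p}\to(Z,a)$, and consequently, for all $\tau$ and $p,q\in\mu\Sigma^{\mathsf p}_\tau$, $[\![p]\!]_\tau=[\![q]\!]_\tau$ implies $p\sim^{\mathsf p}_\tau q$. -/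

import Mathlib

open CategoryTheory CategoryTheory.Limits Opposite Convexity

/-! ### Higher-order coalgebras for a mixed-variance bifunctor -/

section HigherOrder

universe v u

/-- A higher-order coalgebra `V ⟶ B(V, V)` for a bifunctor `B : Cᵒᵖ × C → C` (in curried form). -/
structure HOCoalgebra {C : Type u} [Category.{v} C] (B : Cᵒᵖ ⥤ C ⥤ C) where
  V : C
  str : V ⟶ (B.obj (op V)).obj V

namespace HOCoalgebra

variable {C : Type u} [Category.{v} C] {B : Cᵒᵖ ⥤ C ⥤ C}

/-- Morphisms `h : (C, c) ⟶ (D, d)` of higher-order coalgebras: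
`B(id, h) ∘ c = B(h, id) ∘ d ∘ h` as morphisms `C ⟶ B(C, D)`. -/
@[ext]
structure Hom (P Q : HOCoalgebra B) where
  f : P.V ⟶ Q.V
  h : P.str ≫ (B.obj (op P.V)).map f = f ≫ Q.str ≫ (B.map f.op).app Q.V

instance : Category (HOCoalgebra B) where
  Hom := Hom
  id P := ⟨𝟙 P.V, by simp⟩
  comp {P Q R} f g := ⟨f.f ≫ g.f, by
    have hf := f.h
    have hg := g.h
    simp only [Functor.map_comp, op_comp, NatTrans.comp_app, Category.assoc]
    rw [← Category.assoc, hf]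
    simp only [Category.assoc]
    rw [← (B.map f.f.op).naturality, reassoc_of% hg]⟩

/-- The underlying coalgebra for the endofunctor `B(V, -)`. -/
def toCoalgebra (P : HOCoalgebra B) : Endofunctor.Coalgebra (B.obj (op P.V)) :=
  ⟨P.V, P.str⟩

/-- A higher-order coalgebra `(Z, z)` is locally final if it is a final coalgebra for `B(Z, -)`. -/
def IsLocallyFinal (P : HOCoalgebra B) : Prop :=
  Nonempty (IsTerminal P.toCoalgebra)

end HOCoalgebra

end HigherOrder

namespace XPTCL

/-! ### Types and type-sorted sets -/

/-- Simple types: `τ ::= unit | τ → τ`. -/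
inductive Ty : Type
  | unit : Ty
  | arr : Ty → Ty → Ty

/-- `Ty`-sorted sets. -/
structure TySet : Type 1 where
  El : Ty → Type

instance : CoeFun TySet fun _ => Ty → Type := ⟨TySet.El⟩

/-- The category `Set^Ty` of `Ty`-sorted sets and sortwise maps. -/
instance : Category TySet where
  Hom X Y := ∀ τ : Ty, X τ → Y τ
  id _ := fun _ x => x
  comp f g := fun τ x => g τ (f τ x)

@[simp] theorem id_apply (X : TySet) (τ : Ty) (x : X τ) : (𝟙 X : X ⟶ X) τ x = x := rfl

@[simp] theorem comp_apply {X Y Z : TySet} (f : X ⟶ Y) (g : Y ⟶ Z) (τ : Ty) (x : X τ) :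
    (f ≫ g) τ x = g τ (f τ x) := rfl

theorem TySet.hom_ext {X Y : TySet} {f g : X ⟶ Y} (h : ∀ τ x, f τ x = g τ x) : f = g :=
  funext fun τ => funext fun x => h τ x

/-- Binary products of sorted sets. -/
abbrev prodSet (X Y : TySet) : TySet := ⟨fun τ => X τ × Y τ⟩

def prodMap {X X' Y Y' : TySet} (f : X ⟶ X') (g : Y ⟶ Y') : prodSet X Y ⟶ prodSet X' Y' :=
  fun τ x => (f τ x.1, g τ x.2)

/-- The pairing `⟨f, g⟩`. -/
def pairing {W X Y : TySet} (f : W ⟶ X) (g : W ⟶ Y) : W ⟶ prodSet X Y :=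
  fun τ w => (f τ w, g τ w)

/-- Binary coproducts of sorted sets. -/
abbrev coprodSet (X Y : TySet) : TySet := ⟨fun τ => X τ ⊕ Y τ⟩

def coprodMap {X X' Y Y' : TySet} (f : X ⟶ X') (g : Y ⟶ Y') : coprodSet X Y ⟶ coprodSet X' Y' :=
  fun τ => Sum.map (f τ) (g τ)

/-- The codiagonal `∇ : X + X ⟶ X`. -/
def codiag (X : TySet) : coprodSet X X ⟶ X :=
  fun _ => Sum.elim id id

/-! ### Syntax -/

/-- The polynomial functor of the signature of xPTCL, on objects. Here `s1`, `s2`, `k1` are the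
auxiliary operators `S'`, `S''`, `K'`, and `choice` is the fair probabilistic choice `⊕`. -/
inductive Sig (X : TySet) : Ty → Type
  | e : Sig X Ty.unit
  | app {a b : Ty} : X (Ty.arr a b) → X a → Sig X b
  | s (a b c : Ty) :
      Sig X (Ty.arr (Ty.arr a (Ty.arr b c)) (Ty.arr (Ty.arr a b) (Ty.arr a c)))
  | s1 {a b c : Ty} : X (Ty.arr a (Ty.arr b c)) → Sig X (Ty.arr (Ty.arr a b) (Ty.arr a c))
  | s2 {a b c : Ty} : X (Ty.arr a (Ty.arr b c)) → X (Ty.arr a b) → Sig X (Ty.arr a c)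
  | k (a b : Ty) : Sig X (Ty.arr a (Ty.arr b a))
  | k1 {a : Ty} (b : Ty) : X a → Sig X (Ty.arr b a)
  | i (a : Ty) : Sig X (Ty.arr a a)
  | choice {a : Ty} : X a → X a → Sig X a

def Sig.map {X Y : TySet} (f : X ⟶ Y) : ∀ τ, Sig X τ → Sig Y τ
  | _, .e => .e
  | _, .app p q => .app (f _ p) (f _ q)
  | _, .s a b c => .s a b c
  | _, .s1 p => .s1 (f _ p)
  | _, .s2 p q => .s2 (f _ p) (f _ q)
  | _, .k a b => .k a b
  | _, .k1 b p => .k1 b (f _ p)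
  | _, .i a => .i a
  | _, .choice p q => .choice (f _ p) (f _ q)

/-- The syntax functor `Σ` of xPTCL. -/
def SigF : TySet ⥤ TySet where
  obj X := ⟨Sig X⟩
  map f := Sig.map f
  map_id X := by
    refine funext fun τ => funext fun x => ?_
    cases x <;> rfl
  map_comp {X _ _} f g := by
    refine funext fun τ => funext fun x => ?_
    cases x <;> rfl

/-- `Σ`-terms with variables from the sorted set `V`. -/
inductive Tm (V : TySet) : Ty → Type
  | var {a : Ty} : V a → Tm V a
  | e : Tm V Ty.unit
  | app {a b : Ty} : Tm V (Ty.arr a b) → Tm V a → Tm V b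
  | s (a b c : Ty) :
      Tm V (Ty.arr (Ty.arr a (Ty.arr b c)) (Ty.arr (Ty.arr a b) (Ty.arr a c)))
  | s1 {a b c : Ty} : Tm V (Ty.arr a (Ty.arr b c)) → Tm V (Ty.arr (Ty.arr a b) (Ty.arr a c))
  | s2 {a b c : Ty} : Tm V (Ty.arr a (Ty.arr b c)) → Tm V (Ty.arr a b) → Tm V (Ty.arr a c)
  | k (a b : Ty) : Tm V (Ty.arr a (Ty.arr b a))
  | k1 {a : Ty} (b : Ty) : Tm V a → Tm V (Ty.arr b a)
  | i (a : Ty) : Tm V (Ty.arr a a)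
  | choice {a : Ty} : Tm V a → Tm V a → Tm V a

/-- The free `Σ`-algebra `Σ⋆ V`, as a sorted set. -/
abbrev Free (V : TySet) : TySet := ⟨Tm V⟩

/-- The `Σ`-algebra structure of `Σ⋆ V`. -/
def Free.iota (V : TySet) : SigF.obj (Free V) ⟶ Free V
  | _, .e => Tm.e
  | _, .app p q => Tm.app p q
  | _, .s a b c => Tm.s a b c
  | _, .s1 p => Tm.s1 p
  | _, .s2 p q => Tm.s2 p q
  | _, .k a b => Tm.k a b
  | _, .k1 b p => Tm.k1 b p
  | _, .i a => Tm.i a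
  | _, .choice p q => Tm.choice p q

/-- The unit `V ⟶ Σ⋆ V`. -/
def Free.eta (V : TySet) : V ⟶ Free V := fun _ x => Tm.var x

/-- The free extension of `v : V ⟶ A` to `Σ⋆ V ⟶ A` for a `Σ`-algebra `(A, a)`. -/
def Free.eval {V A : TySet} (v : V ⟶ A) (a : SigF.obj A ⟶ A) : Free V ⟶ A
  | _, .var x => v _ x
  | _, .e => a _ Sig.e
  | _, .app p q => a _ (Sig.app (Free.eval v a _ p) (Free.eval v a _ q))
  | _, .s x y z => a _ (Sig.s x y z)
  | _, .s1 p => a _ (Sig.s1 (Free.eval v a _ p))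
  | _, .s2 p q => a _ (Sig.s2 (Free.eval v a _ p) (Free.eval v a _ q))
  | _, .k x y => a _ (Sig.k x y)
  | _, .k1 y p => a _ (Sig.k1 y (Free.eval v a _ p))
  | _, .i x => a _ (Sig.i x)
  | _, .choice p q => a _ (Sig.choice (Free.eval v a _ p) (Free.eval v a _ q))

theorem Free.iota_eval {V A : TySet} (v : V ⟶ A) (a : SigF.obj A ⟶ A) :
    Free.iota V ≫ Free.eval v a = SigF.map (Free.eval v a) ≫ a := by
  refine TySet.hom_ext fun τ x => ?_
  cases x <;> rfl

theorem Free.eval_unique {V A : TySet} (v : V ⟶ A) (a : SigF.obj A ⟶ A) (h : Free V ⟶ A)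
    (hv : Free.eta V ≫ h = v) (ha : Free.iota V ≫ h = SigF.map h ≫ a) : h = Free.eval v a := by
  have ha' : ∀ τ (x : Sig (Free V) τ), h τ (Free.iota V τ x) = a τ (Sig.map h τ x) :=
    fun τ x => congrFun (congrFun ha τ) x
  refine TySet.hom_ext fun τ t => ?_
  change Tm V τ at t
  induction t with
  | var x => exact congrFun (congrFun hv _) x
  | e => exact ha' _ Sig.e
  | app p q ihp ihq =>
    refine (ha' _ (Sig.app p q)).trans ?_
    change a _ (Sig.app (h _ p) (h _ q)) = _
    rw [ihp, ihq]; rfl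
  | s x y z => exact ha' _ (Sig.s x y z)
  | s1 p ihp =>
    refine (ha' _ (Sig.s1 p)).trans ?_
    change a _ (Sig.s1 (h _ p)) = _
    rw [ihp]; rfl
  | s2 p q ihp ihq =>
    refine (ha' _ (Sig.s2 p q)).trans ?_
    change a _ (Sig.s2 (h _ p) (h _ q)) = _
    rw [ihp, ihq]; rfl
  | k x y => exact ha' _ (Sig.k x y)
  | k1 y p ihp =>
    refine (ha' _ (Sig.k1 y p)).trans ?_
    change a _ (Sig.k1 y (h _ p)) = _
    rw [ihp]; rfl
  | i x => exact ha' _ (Sig.i x)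
  | choice p q ihp ihq =>
    refine (ha' _ (Sig.choice p q)).trans ?_
    change a _ (Sig.choice (h _ p) (h _ q)) = _
    rw [ihp, ihq]; rfl

/-- The action of the free monad `Σ⋆` on morphisms. -/
def Free.map {V W : TySet} (f : V ⟶ W) : Free V ⟶ Free W :=
  Free.eval (f ≫ Free.eta W) (Free.iota W)

/-- The Eilenberg-Moore algebra `â : Σ⋆ A ⟶ A` induced by a `Σ`-algebra `a : Σ A ⟶ A`. -/
def Free.hat {A : TySet} (a : SigF.obj A ⟶ A) : Free A ⟶ A :=
  Free.eval (𝟙 A) a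

/-- The sorted set `μΣ` of closed terms (programs). -/
abbrev Mu : TySet := Free ⟨fun _ => Empty⟩

/-- The `Σ`-algebra of programs. -/
def muAlg : Endofunctor.Algebra SigF := ⟨Mu, Free.iota _⟩

/-- The unique `Σ`-algebra morphism `⟦-⟧ : μΣ ⟶ A`. -/
def den (A : Endofunctor.Algebra SigF) : muAlg ⟶ A where
  f := Free.eval (fun _ x => x.elim) A.str
  h := (Free.iota_eval _ _).symm

/-- `μΣ` is the initial `Σ`-algebra. -/
def muInitial : IsInitial muAlg :=
  IsInitial.ofUniqueHom den fun _ m =>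
    Endofunctor.Algebra.Hom.ext
      (Free.eval_unique _ _ m.f (TySet.hom_ext fun _ x => x.elim) m.h.symm)

/-! ### Behaviour -/

/-- The finite distribution functor on objects. -/
abbrev Dist (X : Type) : Type := StdSimplex ℝ X

/-- The observable (non-reduction) part of the behaviour: `1` at `unit`, and `X_a → Y_b` at
`a → b`. -/
def Obs (X Y : TySet) : Ty → Type
  | .unit => Unit
  | .arr a b => X a → Y b

def Obs.map {X X' Y Y' : TySet} (f : X' ⟶ X) (g : Y ⟶ Y') : ∀ τ, Obs X Y τ → Obs X' Y' τ
  | .unit, x => x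
  | .arr a b, h => fun x => g b (h (f a x))

/-- `B_unit(X, Y) = D(Y_unit) + 1` and `B_{a → b}(X, Y) = D(Y_{a → b}) + (X_a → Y_b)`. -/
abbrev BObj (X Y : TySet) : TySet := ⟨fun τ => Dist (Y τ) ⊕ Obs X Y τ⟩

noncomputable def BMap {X X' Y Y' : TySet} (f : X' ⟶ X) (g : Y ⟶ Y') : BObj X Y ⟶ BObj X' Y' :=
  fun τ => Sum.map (StdSimplex.map (g τ)) (Obs.map f g τ)

theorem BMap_id (X Y : TySet) : BMap (𝟙 X) (𝟙 Y) = 𝟙 (BObj X Y) := by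
  refine TySet.hom_ext fun τ x => ?_
  rcases x with φ | h
  · exact congrArg Sum.inl (StdSimplex.map_id φ)
  · cases τ <;> rfl

theorem BMap_comp {X X' X'' Y Y' Y'' : TySet} (f : X' ⟶ X) (f' : X'' ⟶ X') (g : Y ⟶ Y')
    (g' : Y' ⟶ Y'') : BMap f g ≫ BMap f' g' = BMap (f' ≫ f) (g ≫ g') := by
  refine TySet.hom_ext fun τ x => ?_
  rcases x with φ | h
  · exact congrArg Sum.inl (StdSimplex.map_map φ (g τ) (g' τ))
  · cases τ <;> rfl

/-- The behaviour bifunctor of xPTCL. -/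
noncomputable def Bp : TySetᵒᵖ ⥤ TySet ⥤ TySet where
  obj X :=
    { obj := fun Y => BObj X.unop Y
      map := fun g => BMap (𝟙 X.unop) g
      map_id := fun Y => BMap_id _ Y
      map_comp := fun g g' => (BMap_comp (𝟙 X.unop) (𝟙 X.unop) g g').symm }
  map f :=
    { app := fun Y => BMap f.unop (𝟙 Y)
      naturality := fun _ _ g => (BMap_comp _ _ _ _).trans (BMap_comp f.unop (𝟙 _) (𝟙 _) g).symm }
  map_id X := by
    ext Y
    exact BMap_id X.unop Y
  map_comp f f' := by
    ext Y
    exact (BMap_comp f.unop f'.unop (𝟙 Y) (𝟙 Y)).symm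

/-! ### Higher-order GSOS laws -/

/-- A higher-order GSOS law `ρ_{X,Y} : Σ (X × B(X,Y)) ⟶ B(X, Σ⋆ (X + Y))` of the syntax functor
over a bifunctor `B`, natural in `Y` and dinatural in `X`. -/
structure GSOSLaw (B : TySetᵒᵖ ⥤ TySet ⥤ TySet) where
  app (X Y : TySet) :
    SigF.obj (prodSet X ((B.obj (op X)).obj Y)) ⟶ (B.obj (op X)).obj (Free (coprodSet X Y))
  natural (X : TySet) {Y Y' : TySet} (g : Y ⟶ Y') :
    SigF.map (prodMap (𝟙 X) ((B.obj (op X)).map g)) ≫ app X Y' =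
      app X Y ≫ (B.obj (op X)).map (Free.map (coprodMap (𝟙 X) g))
  dinatural {X X' : TySet} (f : X ⟶ X') (Y : TySet) :
    SigF.map (prodMap (𝟙 X) ((B.map f.op).app Y)) ≫ app X Y ≫
        (B.obj (op X)).map (Free.map (coprodMap f (𝟙 Y))) =
      SigF.map (prodMap f (𝟙 ((B.obj (op X')).obj Y))) ≫ app X' Y ≫
        (B.map f.op).app (Free (coprodSet X' Y))

/-- Arguments (formal variables of `X`) as terms over `X + Y`. -/
def vl {X Y : TySet} {a : Ty} (x : X a) : Tm (coprodSet X Y) a := Tm.var (Sum.inl x)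

/-- Successors (formal variables of `Y`) as terms over `X + Y`. -/
def vr {X Y : TySet} {a : Ty} (y : Y a) : Tm (coprodSet X Y) a := Tm.var (Sum.inr y)

/-- The operational rules of xPTCL. In each clause, `p.1` is an argument and `p.2` its behaviour;
`inl` is a probabilistic reduction step, `inr` is the termination signal or a function. -/
noncomputable def rho (X Y : TySet) : ∀ τ, Sig (prodSet X (BObj X Y)) τ →
    BObj X (Free (coprodSet X Y)) τ
  | _, .e => Sum.inr ()
  | _, .app (p : prodSet X (BObj X Y) (Ty.arr _ _)) q =>
      match p.2 with
      | Sum.inl φ => Sum.inl (φ.map fun p' => Tm.app (vr p') (vl q.1))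
      | Sum.inr f => Sum.inl (StdSimplex.single (vr (f q.1)))
  | _, .s _ _ _ => Sum.inr fun t => Tm.s1 (vl t)
  | _, .s1 p => Sum.inr fun t => Tm.s2 (vl p.1) (vl t)
  | _, .s2 p q => Sum.inr fun t => Tm.app (Tm.app (vl p.1) (vl t)) (Tm.app (vl q.1) (vl t))
  | _, .k _ b => Sum.inr fun t => Tm.k1 b (vl t)
  | _, .k1 _ p => Sum.inr fun _ => vl p.1
  | _, .i _ => Sum.inr fun t => vl t
  | _, .choice p q => Sum.inl (StdSimplex.duple (vl p.1) (vl q.1)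
      (by norm_num : (0 : ℝ) ≤ 1 / 2) (by norm_num : (0 : ℝ) ≤ 1 / 2) (by norm_num))

/-- The higher-order GSOS law of xPTCL. -/
noncomputable def rhoP : GSOSLaw Bp where
  app X Y := rho X Y
  natural X Y Y' g := by
    refine TySet.hom_ext fun τ x => ?_
    cases x with
    | app p q =>
      rcases p with ⟨p, φ | f⟩
      · refine congrArg Sum.inl ?_
        change StdSimplex.map _ (StdSimplex.map _ φ) = StdSimplex.map _ (StdSimplex.map _ φ)
        rw [StdSimplex.map_map, StdSimplex.map_map]
        rfl
      · refine congrArg Sum.inl (Eq.symm ?_)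
        exact StdSimplex.map_single _ _
    | choice p q =>
      refine congrArg Sum.inl (Eq.symm ?_)
      exact StdSimplex.map_duple _ _ _ _ _ _
    | _ => rfl
  dinatural f Y := by
    refine TySet.hom_ext fun τ x => ?_
    cases x with
    | app p q =>
      rcases p with ⟨p, φ | h⟩
      · refine congrArg Sum.inl ?_
        change StdSimplex.map _ (StdSimplex.map _ (StdSimplex.map _ φ)) =
          StdSimplex.map _ (StdSimplex.map _ φ)
        rw [StdSimplex.map_map, StdSimplex.map_map, StdSimplex.map_map]
        rfl
      · refine congrArg Sum.inl ((StdSimplex.map_single _ _).trans (Eq.symm ?_))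
        exact StdSimplex.map_single _ _
    | choice p q =>
      refine congrArg Sum.inl ((StdSimplex.map_duple _ _ _ _ _ _).trans (Eq.symm ?_))
      exact StdSimplex.map_duple _ _ _ _ _ _
    | _ => rfl

/-- Primitive recursion on programs: the map `h : μΣ ⟶ A` with `h ∘ ι = a ∘ Σ ⟨id, h⟩`. -/
def primrec {A : TySet} (a : SigF.obj (prodSet Mu A) ⟶ A) : Mu ⟶ A
  | _, .var x => x.elim
  | _, .e => a _ Sig.e
  | _, .app p q => a _ (Sig.app (p, primrec a _ p) (q, primrec a _ q))
  | _, .s x y z => a _ (Sig.s x y z)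
  | _, .s1 p => a _ (Sig.s1 (p, primrec a _ p))
  | _, .s2 p q => a _ (Sig.s2 (p, primrec a _ p) (q, primrec a _ q))
  | _, .k x y => a _ (Sig.k x y)
  | _, .k1 y p => a _ (Sig.k1 y (p, primrec a _ p))
  | _, .i x => a _ (Sig.i x)
  | _, .choice p q => a _ (Sig.choice (p, primrec a _ p) (q, primrec a _ q))

/-- For a `Σ`-algebra `a : Σ X ⟶ X`, the composite
`B(id, â ∘ Σ⋆ ∇) ∘ ρ_{X,X} : Σ (X × B(X,X)) ⟶ B(X,X)`. -/
def GSOSLaw.interp {B : TySetᵒᵖ ⥤ TySet ⥤ TySet} (ρ : GSOSLaw B) {X : TySet}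
    (a : SigF.obj X ⟶ X) :
    SigF.obj (prodSet X ((B.obj (op X)).obj X)) ⟶ (B.obj (op X)).obj X :=
  ρ.app X X ≫ (B.obj (op X)).map (Free.map (codiag X) ≫ Free.hat a)

/-- The operational model `γ : μΣ ⟶ B(μΣ, μΣ)` of a higher-order GSOS law. -/
def GSOSLaw.opModel {B : TySetᵒᵖ ⥤ TySet ⥤ TySet} (ρ : GSOSLaw B) : HOCoalgebra B where
  V := Mu
  str := primrec (ρ.interp muAlg.str)

/-- `(X, a, c)` is a `ρ`-bialgebra, for `X` and `c` given by a higher-order coalgebra. -/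
def GSOSLaw.IsBialgebra {B : TySetᵒᵖ ⥤ TySet ⥤ TySet} (ρ : GSOSLaw B) (P : HOCoalgebra B)
    (a : SigF.obj P.V ⟶ P.V) : Prop :=
  a ≫ P.str = SigF.map (pairing (𝟙 P.V) P.str) ≫ ρ.interp a

/-- The operational model is a `ρ`-bialgebra. -/
theorem GSOSLaw.opModel_isBialgebra {B : TySetᵒᵖ ⥤ TySet ⥤ TySet} (ρ : GSOSLaw B) :
    ρ.IsBialgebra ρ.opModel muAlg.str := by
  refine TySet.hom_ext fun τ x => ?_
  cases x <;> rfl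

/-- A denotational model is a `ρ`-bialgebra whose higher-order coalgebra is locally final. -/
def GSOSLaw.IsDenotationalModel {B : TySetᵒᵖ ⥤ TySet ⥤ TySet} (ρ : GSOSLaw B)
    (P : HOCoalgebra B) (a : SigF.obj P.V ⟶ P.V) : Prop :=
  P.IsLocallyFinal ∧ ρ.IsBialgebra P a

/-- A `Σ`-algebra is adequate if `beh`, the unique `B(μΣ, -)`-coalgebra morphism from the
operational model to the final `B(μΣ, -)`-coalgebra (which is required to exist), factorizes
through `⟦-⟧`. -/
def GSOSLaw.IsAdequate {B : TySetᵒᵖ ⥤ TySet ⥤ TySet} (ρ : GSOSLaw B)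
    (A : Endofunctor.Algebra SigF) : Prop :=
  (∃ N : Endofunctor.Coalgebra (B.obj (op Mu)), Nonempty (IsTerminal N)) ∧
    ∀ (N : Endofunctor.Coalgebra (B.obj (op Mu))) (hN : IsTerminal N),
      ∃ m : A.a ⟶ N.V, (den A).f ≫ m = (hN.from ρ.opModel.toCoalgebra).f

/-! ### Strong probabilistic applicative bisimilarity -/

/-- The operational model of xPTCL. -/
noncomputable def gammaP (τ : Ty) (p : Mu τ) : BObj Mu Mu τ := rhoP.opModel.str τ p

/-- Two distributions on programs give the same probability to each equivalence class. -/
def DistRel {X : Type} (r : Setoid X) (φ ψ : Dist X) : Prop :=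
  ∀ E ∈ r.classes, ∑ᶠ t ∈ E, φ.weights t = ∑ᶠ t ∈ E, ψ.weights t

/-- Termination signals are related; functions are related if they send each argument to
related results. -/
def ObsRel (R : ∀ τ, Setoid (Mu τ)) : ∀ τ, Obs Mu Mu τ → Obs Mu Mu τ → Prop
  | .unit, _, _ => True
  | .arr a b, f, g => ∀ t : Mu a, R b (f t) (g t)

/-- `R` is a strong probabilistic applicative bisimulation (a `Ty`-indexed equivalence relation). -/
def IsBisimulation (R : ∀ τ, Setoid (Mu τ)) : Prop :=
  ∀ τ (p q : Mu τ), R τ p q →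
    Sum.LiftRel (DistRel (R τ)) (ObsRel R τ) (gammaP τ p) (gammaP τ q)

/-- Strong probabilistic applicative bisimilarity: the supremum of all bisimulations. -/
noncomputable def Bisimilarity : ∀ τ, Setoid (Mu τ) :=
  sSup {R | IsBisimulation R}

end XPTCL

open XPTCL

namespace XPTCL

/-! ### Final coalgebras of `D(-) + K` -/

/-! In `B(X, -)` at sort `a → b`, the sort itself occurs only under `D`; the function part involves
the strictly smaller sorts `a` and `b`. So finality splits along sorts: a coalgebra of `B(X, -)` is
final iff each component is final for `D(-) + K`, where `K` is the set of observations at that sort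
(`isTerminalOfSortwise`, `sortwise_of_isTerminal`). Final coalgebras of `D(-) + K` exist because
this functor is a quotient of a polynomial functor. Recursion on types then yields the final
coalgebra of `B(X, -)`. It also yields a locally final one, since the domain `Z a` is already
available when sort `a → b` is treated. Recursion with bijections shows that locally final
coalgebras are isomorphic.

Bisimilarity is the kernel of `beh`: kernels of coalgebra morphisms are bisimulations, and the
quotient by a bisimulation is again a coalgebra, through which `beh` factors.

On a locally final `Z`, application is defined by corecursion and every other operator by inverting
the structure map, which is bijective by Lambek's lemma. Adequacy holds for any bialgebra:
structural induction (`map_den_gammaP`) shows that `⟦-⟧` is a morphism of higher-order coalgebras.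
Restricting the arguments of functions in `Z` along `⟦-⟧` makes `Z` a coalgebra of `B(μΣ, -)`, and
`beh` is `⟦-⟧` followed by the unique morphism from it. -/

/-- The functor `D(-) + K` for a constant set `K`. -/
def DistSum (K Y : Type) : Type := Dist Y ⊕ K

noncomputable instance (K : Type) : Functor (DistSum K) where
  map f := Sum.map (StdSimplex.map f) id

theorem StdSimplex.map_congr_support {X Y : Type} (φ : Dist X) {f g : X → Y}
    (h : ∀ x ∈ φ.weights.support, f x = g x) : φ.map f = φ.map g := by
  ext1
  exact Finsupp.mapDomain_congr h

/-- The support is finite and nonempty, hence the range of a sequence `f`; pushing `φ` back along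
`invFun f` loses nothing, as `f ∘ invFun f` is the identity on the support. -/
theorem StdSimplex.exists_map_nat {X : Type} (φ : Dist X) :
    ∃ (ψ : Dist ℕ) (f : ℕ → X), ψ.map f = φ := by
  obtain ⟨f, hf⟩ := (φ.weights.support.countable_toSet).exists_eq_range
    (Finset.coe_nonempty.2 φ.support_weights_nonempty)
  refine ⟨φ.map (Function.invFun f), f, ?_⟩
  rw [StdSimplex.map_map]
  refine (StdSimplex.map_congr_support φ (g := id) fun x hx => ?_).trans (StdSimplex.map_id φ)
  have hx' : x ∈ Set.range f := hf ▸ hx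
  exact Function.invFun_eq hx'

/-- `D(-) + K` as a quotient of a polynomial functor: distributions are represented by
distributions on `ℕ` together with a labelling. -/
noncomputable instance (K : Type) : QPF (DistSum K) where
  P := ⟨Dist ℕ ⊕ K, Sum.elim (fun _ => ℕ) (fun _ => Empty)⟩
  abs
    | ⟨Sum.inl ψ, f⟩ => Sum.inl (ψ.map f)
    | ⟨Sum.inr k, _⟩ => Sum.inr k
  repr
    | Sum.inl φ => ⟨Sum.inl (StdSimplex.exists_map_nat φ).choose,
        (StdSimplex.exists_map_nat φ).choose_spec.choose⟩
    | Sum.inr k => ⟨Sum.inr k, Empty.elim⟩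
  abs_repr
    | Sum.inl φ => congrArg Sum.inl (StdSimplex.exists_map_nat φ).choose_spec.choose_spec
    | Sum.inr _ => rfl
  abs_map f
    | ⟨Sum.inl ψ, g⟩ => congrArg Sum.inl (StdSimplex.map_map ψ g f).symm
    | ⟨Sum.inr _, _⟩ => rfl

/-- `(W, w)` is a final coalgebra of `D(-) + K`. -/
def IsFinalDist {K W : Type} (w : W → Dist W ⊕ K) : Prop :=
  ∀ (C : Type) (c : C → Dist C ⊕ K),
    ∃! f : C → W, ∀ x, w (f x) = Sum.map (StdSimplex.map f) id (c x)

/-- The carrier of the final coalgebra of `D(-) + K`. -/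
def NuDist (K : Type) : Type := QPF.Cofix (DistSum K)

noncomputable def NuDist.dest {K : Type} : NuDist K → Dist (NuDist K) ⊕ K :=
  QPF.Cofix.dest (F := DistSum K)

theorem NuDist.isFinalDist_dest (K : Type) : IsFinalDist (NuDist.dest (K := K)) := by
  intro C c
  refine ⟨QPF.Cofix.corec (F := DistSum K) c, QPF.Cofix.dest_corec (F := DistSum K) c, ?_⟩
  intro g hg
  funext x
  -- Uniqueness by coinduction: relating `g x` to `corec c x` for every `x`, both structures agree
  -- once related elements are identified.
  refine QPF.Cofix.bisim_rel (F := DistSum K)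
    (fun u v => ∃ x, u = g x ∧ v = QPF.Cofix.corec (F := DistSum K) c x) ?_ _ _ ⟨x, rfl, rfl⟩
  rintro _ _ ⟨x, rfl, rfl⟩
  refine (congrArg (Sum.map (StdSimplex.map _) id) (hg x)).trans (Eq.trans ?_
    (congrArg (Sum.map (StdSimplex.map _) id)
      (QPF.Cofix.dest_corec (F := DistSum K) c x)).symm)
  change Sum.map (StdSimplex.map _) id (Sum.map (StdSimplex.map g) id (c x)) =
    Sum.map (StdSimplex.map _) id (Sum.map (StdSimplex.map _) id (c x))
  rcases c x with φ | k
  · refine congrArg Sum.inl ((StdSimplex.map_map φ _ _).trans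
      (Eq.trans ?_ (StdSimplex.map_map φ _ _).symm))
    exact congrArg (fun h => StdSimplex.map h φ) (funext fun y => Quot.sound ⟨y, rfl, rfl⟩)
  · rfl

theorem sumMap_dist_comp {A B C K L M : Type} (f : A → B) (g : B → C) (k : K → L) (l : L → M)
    (x : Dist A ⊕ K) :
    Sum.map (StdSimplex.map g) l (Sum.map (StdSimplex.map f) k x) =
      Sum.map (StdSimplex.map (g ∘ f)) (l ∘ k) x := by
  rcases x with φ | k
  · exact congrArg Sum.inl (StdSimplex.map_map φ f g)
  · rfl

theorem sumMap_dist_id {A K : Type} (x : Dist A ⊕ K) :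
    Sum.map (StdSimplex.map id) id x = x := by
  rcases x with φ | k
  · exact congrArg Sum.inl (StdSimplex.map_id φ)
  · rfl

theorem IsFinalDist.hom_ext {K W C : Type} {w : W → Dist W ⊕ K} (hw : IsFinalDist w)
    (c : C → Dist C ⊕ K) {f g : C → W}
    (hf : ∀ x, w (f x) = Sum.map (StdSimplex.map f) id (c x))
    (hg : ∀ x, w (g x) = Sum.map (StdSimplex.map g) id (c x)) : f = g :=
  (hw C c).unique hf hg

/-- Lambek's lemma for `D(-) + K`. -/
theorem IsFinalDist.bijective {K W : Type} {w : W → Dist W ⊕ K} (hw : IsFinalDist w) :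
    Function.Bijective w := by
  obtain ⟨f, hf, -⟩ := hw (Dist W ⊕ K) (Sum.map (StdSimplex.map w) id)
  have hl : f ∘ w = id := by
    refine hw.hom_ext w (fun x => ?_) fun x => (sumMap_dist_id _).symm
    exact (hf (w x)).trans (sumMap_dist_comp _ _ _ _ _)
  refine Function.bijective_iff_has_inverse.2 ⟨f, congrFun hl, fun x => ?_⟩
  rw [hf, sumMap_dist_comp, hl]
  exact sumMap_dist_id x

/-- Final coalgebras for isomorphic constants are isomorphic. -/
theorem IsFinalDist.exists_equiv {K K' W W' : Type} {w : W → Dist W ⊕ K} {w' : W' → Dist W' ⊕ K'}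
    (hw : IsFinalDist w) (hw' : IsFinalDist w') (k : K ≃ K') :
    ∃ e : W ≃ W', ∀ x, w' (e x) = Sum.map (StdSimplex.map e) k (w x) := by
  obtain ⟨f, hf, -⟩ := hw' W fun x => Sum.map id k (w x)
  obtain ⟨g, hg, -⟩ := hw W' fun x => Sum.map id k.symm (w' x)
  have hf' : ∀ x, w' (f x) = Sum.map (StdSimplex.map f) k (w x) := fun x => by
    rw [hf, Sum.map_map]; rfl
  have hg' : ∀ x, w (g x) = Sum.map (StdSimplex.map g) k.symm (w' x) := fun x => by
    rw [hg, Sum.map_map]; rfl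
  have hgf : g ∘ f = id := by
    refine hw.hom_ext w (fun x => ?_) fun x => (sumMap_dist_id _).symm
    rw [Function.comp_apply, hg', hf', sumMap_dist_comp, k.symm_comp_self]
  have hfg : f ∘ g = id := by
    refine hw'.hom_ext w' (fun x => ?_) fun x => (sumMap_dist_id _).symm
    rw [Function.comp_apply, hf', hg', sumMap_dist_comp, k.self_comp_symm]
  exact ⟨⟨f, g, congrFun hgf, congrFun hfg⟩, hf'⟩

/-- The constant may change along with the carrier. This is needed because the observations at `a →
b` depend on the carrier at `b`, so isomorphic coalgebras of `B(X, -)` have different, merely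
equipotent, constants. -/
theorem IsFinalDist.of_equiv {K K' W W' : Type} {w : W → Dist W ⊕ K} {w' : W' → Dist W' ⊕ K'}
    (hw' : IsFinalDist w') (e : W ≃ W') (k : K ≃ K')
    (h : ∀ x, w' (e x) = Sum.map (StdSimplex.map e) k (w x)) : IsFinalDist w := by
  have h' : ∀ y, w (e.symm y) = Sum.map (StdSimplex.map e.symm) k.symm (w' y) := fun y => by
    obtain ⟨x, rfl⟩ := e.surjective y
    rw [h, sumMap_dist_comp, e.symm_comp_self, k.symm_comp_self, sumMap_dist_id,
      e.symm_apply_apply]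
  intro C c
  obtain ⟨f, hf, hu⟩ := hw' C fun x => Sum.map id k (c x)
  refine ⟨e.symm ∘ f, fun x => ?_, fun g hg => ?_⟩
  · rw [Function.comp_apply, h', hf, sumMap_dist_comp, Sum.map_map]
    congr 1
    funext y
    exact k.symm_apply_apply y
  · have : e ∘ g = f := hu _ fun x => by
      rw [Function.comp_apply, h, hg, sumMap_dist_comp, Sum.map_map]; rfl
    rw [← this]
    funext x
    exact (e.symm_apply_apply _).symm

/-! ### Final coalgebras of `B(X, -)` -/

/-- The component at a sort of a coalgebra of `B(X, -)`. -/
def sortStr {X : TySet} (P : Endofunctor.Coalgebra (Bp.obj (op X))) (τ : Ty) :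
    P.V τ → Dist (P.V τ) ⊕ Obs X P.V τ :=
  P.str τ

section Terminal

variable {X : TySet} {P : Endofunctor.Coalgebra (Bp.obj (op X))}

theorem sortStr_hom {Q : Endofunctor.Coalgebra (Bp.obj (op X))} (f : P ⟶ Q) (τ : Ty) (x : P.V τ) :
    sortStr Q τ (f.f τ x) =
      Sum.map (StdSimplex.map (f.f τ)) (Obs.map (𝟙 X) f.f τ) (sortStr P τ x) :=
  (congrFun (congrFun f.h τ) x).symm

/-- The coalgebra morphism into a sortwise final coalgebra. -/
noncomputable def sortLift (hP : ∀ τ, IsFinalDist (sortStr P τ))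
    (C : Endofunctor.Coalgebra (Bp.obj (op X))) : ∀ τ, C.V τ → P.V τ
  | .unit => (hP .unit (C.V .unit) (sortStr C .unit)).choose
  -- Postcomposing functions with the lift at `b` turns this component of `C` into a coalgebra for
  -- the constant `X a → P.V b`, to which `hP` applies.
  | .arr a b => (hP (.arr a b) (C.V (.arr a b)) fun x =>
      Sum.map id (fun (h : X a → C.V b) => sortLift hP C b ∘ h) (sortStr C (.arr a b) x)).choose

theorem sortLift_spec (hP : ∀ τ, IsFinalDist (sortStr P τ))
    (C : Endofunctor.Coalgebra (Bp.obj (op X))) (τ : Ty) (x : C.V τ) :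
    sortStr P τ (sortLift hP C τ x) =
      Sum.map (StdSimplex.map (sortLift hP C τ)) (Obs.map (𝟙 X) (sortLift hP C) τ)
        (sortStr C τ x) := by
  cases τ with
  | unit => exact (hP .unit (C.V .unit) (sortStr C .unit)).choose_spec.1 x
  | arr a b =>
    refine ((hP (.arr a b) (C.V (.arr a b)) fun x =>
      Sum.map id (fun (h : X a → C.V b) => sortLift hP C b ∘ h)
        (sortStr C (.arr a b) x)).choose_spec.1 x).trans ?_
    exact Sum.map_map (f' := StdSimplex.map (sortLift hP C (.arr a b))) (g' := id) _ _ _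

/-- A sortwise final coalgebra is final. -/
noncomputable def isTerminalOfSortwise (hP : ∀ τ, IsFinalDist (sortStr P τ)) : IsTerminal P :=
  IsTerminal.ofUniqueHom
    (fun C => ⟨sortLift hP C, TySet.hom_ext fun τ x => (sortLift_spec hP C τ x).symm⟩)
    (by
      intro C m
      refine Endofunctor.Coalgebra.Hom.ext (funext fun τ => ?_)
      change m.f τ = sortLift hP C τ
      induction τ with
      | unit =>
        exact (hP .unit).hom_ext _ (sortStr_hom m .unit) (sortLift_spec hP C .unit)
      | arr a b _ ihb =>
        -- By `ihb`, postcomposition with `m` and with the lift agree at sort `b`, so both maps are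
        -- morphisms from the same coalgebra of `D(-) + K`.
        refine (hP (.arr a b)).hom_ext
          (fun x => Sum.map id (Obs.map (𝟙 X) m.f (.arr a b)) (sortStr C (.arr a b) x))
          (fun x => ?_) (fun x => ?_)
        · rw [sortStr_hom, Sum.map_map]; rfl
        · rw [sortLift_spec, Sum.map_map]
          congr 1
          funext h y
          exact (congrFun ihb _).symm)

end Terminal

/-- The carrier of the final coalgebra of `B(X, -)`. -/
def NuEl (X : TySet) : Ty → Type
  | .unit => NuDist Unit
  | .arr a b => NuDist (X a → NuEl X b)

noncomputable def NuEl.dest (X : TySet) :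
    ∀ τ, NuEl X τ → Dist (NuEl X τ) ⊕ Obs X ⟨NuEl X⟩ τ
  | .unit => NuDist.dest (K := Unit)
  | .arr a b => NuDist.dest (K := X a → NuEl X b)

/-- The final coalgebra of `B(X, -)`. -/
noncomputable def nuCoalg (X : TySet) : Endofunctor.Coalgebra (Bp.obj (op X)) where
  V := ⟨NuEl X⟩
  str := NuEl.dest X

theorem nuCoalg_sortwise (X : TySet) (τ : Ty) : IsFinalDist (sortStr (nuCoalg X) τ) := by
  cases τ with
  | unit => exact NuDist.isFinalDist_dest Unit
  | arr a b => exact NuDist.isFinalDist_dest (X a → NuEl X b)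

noncomputable def nuCoalg_isTerminal (X : TySet) : IsTerminal (nuCoalg X) :=
  isTerminalOfSortwise (nuCoalg_sortwise X)

/-- The action of a sortwise bijection on observations. -/
def Obs.equiv {X X' Y Y' : TySet} (d : ∀ τ, X τ ≃ X' τ) (e : ∀ τ, Y τ ≃ Y' τ) :
    ∀ τ, Obs X Y τ ≃ Obs X' Y' τ
  | .unit => Equiv.refl Unit
  | .arr a b => Equiv.arrowCongr (d a) (e b)

/-- A final coalgebra of `B(X, -)` is sortwise final. -/
theorem sortwise_of_isTerminal {X : TySet} {P : Endofunctor.Coalgebra (Bp.obj (op X))}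
    (hP : IsTerminal P) (τ : Ty) : IsFinalDist (sortStr P τ) := by
  let i : P ≅ nuCoalg X := hP.uniqueUpToIso (nuCoalg_isTerminal X)
  have h1 : i.hom.f ≫ i.inv.f = 𝟙 P.V := congrArg Endofunctor.Coalgebra.Hom.f i.hom_inv_id
  have h2 : i.inv.f ≫ i.hom.f = 𝟙 (nuCoalg X).V :=
    congrArg Endofunctor.Coalgebra.Hom.f i.inv_hom_id
  let e : ∀ τ, P.V τ ≃ (nuCoalg X).V τ := fun τ =>
    ⟨i.hom.f τ, i.inv.f τ, fun x => congrFun (congrFun h1 τ) x,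
      fun x => congrFun (congrFun h2 τ) x⟩
  refine (nuCoalg_sortwise X τ).of_equiv (e τ) (Obs.equiv (fun _ => Equiv.refl _) e τ) fun x => ?_
  refine (sortStr_hom i.hom τ x).trans ?_
  cases τ <;> rfl

/-! ### Locally final coalgebras -/

/-- The carrier of the locally final coalgebra. -/
def LocEl : Ty → Type
  | .unit => NuDist Unit
  | .arr a b => NuDist (LocEl a → LocEl b)

noncomputable def LocEl.dest : ∀ τ, LocEl τ → Dist (LocEl τ) ⊕ Obs ⟨LocEl⟩ ⟨LocEl⟩ τ
  | .unit => NuDist.dest (K := Unit)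
  | .arr a b => NuDist.dest (K := LocEl a → LocEl b)

noncomputable def locCoalg : HOCoalgebra Bp where
  V := ⟨LocEl⟩
  str := LocEl.dest

theorem locCoalg_isLocallyFinal : locCoalg.IsLocallyFinal := by
  refine ⟨isTerminalOfSortwise fun τ => ?_⟩
  cases τ with
  | unit => exact NuDist.isFinalDist_dest Unit
  | arr a b => exact NuDist.isFinalDist_dest (LocEl a → LocEl b)

/-- The component at a sort of a higher-order coalgebra. -/
def hoStr (Z : HOCoalgebra Bp) (τ : Ty) : Z.V τ → Dist (Z.V τ) ⊕ Obs Z.V Z.V τ := Z.str τ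

theorem HOCoalgebra.IsLocallyFinal.sortwise {Z : HOCoalgebra Bp} (hZ : Z.IsLocallyFinal) (τ : Ty) :
    IsFinalDist (hoStr Z τ) :=
  hZ.elim fun h => sortwise_of_isTerminal h τ

section Unique

variable {Z Z' : HOCoalgebra Bp}

/-- The comparison between two sortwise final higher-order coalgebras. -/
noncomputable def locEquiv (hZ : ∀ τ, IsFinalDist (hoStr Z τ))
    (hZ' : ∀ τ, IsFinalDist (hoStr Z' τ)) : ∀ τ, Z.V τ ≃ Z'.V τ
  | .unit => ((hZ .unit).exists_equiv (hZ' .unit) (Equiv.refl Unit)).choose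
  -- Functions are transported by conjugation, which needs the inverse at the domain sort; hence the
  -- recursion builds bijections and not just maps.
  | .arr a b => ((hZ (.arr a b)).exists_equiv (hZ' (.arr a b))
      (Equiv.arrowCongr (locEquiv hZ hZ' a) (locEquiv hZ hZ' b))).choose

theorem locEquiv_spec (hZ : ∀ τ, IsFinalDist (hoStr Z τ))
    (hZ' : ∀ τ, IsFinalDist (hoStr Z' τ)) (τ : Ty) (x : Z.V τ) :
    hoStr Z' τ (locEquiv hZ hZ' τ x) =
      Sum.map (StdSimplex.map (locEquiv hZ hZ' τ))
        (Obs.equiv (locEquiv hZ hZ') (locEquiv hZ hZ') τ) (hoStr Z τ x) := by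
  cases τ with
  | unit => exact ((hZ .unit).exists_equiv (hZ' .unit) (Equiv.refl Unit)).choose_spec x
  | arr a b =>
    exact ((hZ (.arr a b)).exists_equiv (hZ' (.arr a b))
      (Equiv.arrowCongr (locEquiv hZ hZ' a) (locEquiv hZ hZ' b))).choose_spec x

/-- A sortwise bijection compatible with the structures is a morphism. -/
def homOfEquiv (e : ∀ τ, Z.V τ ≃ Z'.V τ)
    (h : ∀ τ x, hoStr Z' τ (e τ x) =
      Sum.map (StdSimplex.map (e τ)) (Obs.equiv e e τ) (hoStr Z τ x)) : Z ⟶ Z' where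
  f := fun τ => e τ
  h := by
    refine TySet.hom_ext fun τ x => ?_
    change Sum.map (StdSimplex.map (e τ)) (Obs.map (𝟙 _) (fun τ => e τ) τ) (hoStr Z τ x) =
      Sum.map (StdSimplex.map id) (Obs.map (fun τ => e τ) (𝟙 Z'.V) τ) (hoStr Z' τ (e τ x))
    rw [h, sumMap_dist_comp]
    congr 1
    cases τ with
    | unit => rfl
    | arr a b =>
      funext g y
      change e b (g y) = e b (g ((e a).symm (e a y)))
      rw [Equiv.symm_apply_apply]

theorem equiv_symm_spec (e : ∀ τ, Z.V τ ≃ Z'.V τ)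
    (h : ∀ τ x, hoStr Z' τ (e τ x) =
      Sum.map (StdSimplex.map (e τ)) (Obs.equiv e e τ) (hoStr Z τ x)) (τ : Ty) (y : Z'.V τ) :
    hoStr Z τ ((e τ).symm y) =
      Sum.map (StdSimplex.map (e τ).symm)
        (Obs.equiv (fun τ => (e τ).symm) (fun τ => (e τ).symm) τ) (hoStr Z' τ y) := by
  obtain ⟨x, rfl⟩ := (e τ).surjective y
  have hk : Obs.equiv (fun τ => (e τ).symm) (fun τ => (e τ).symm) τ = (Obs.equiv e e τ).symm := by
    cases τ <;> rfl
  rw [h, sumMap_dist_comp, hk, Equiv.symm_comp_self, Equiv.symm_comp_self, sumMap_dist_id,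
    Equiv.symm_apply_apply]

theorem HOCoalgebra.IsLocallyFinal.nonempty_iso (hZ : Z.IsLocallyFinal)
    (hZ' : Z'.IsLocallyFinal) : Nonempty (Z ≅ Z') := by
  have h := locEquiv_spec (HOCoalgebra.IsLocallyFinal.sortwise hZ)
    (HOCoalgebra.IsLocallyFinal.sortwise hZ')
  set e := locEquiv (HOCoalgebra.IsLocallyFinal.sortwise hZ)
    (HOCoalgebra.IsLocallyFinal.sortwise hZ')
  refine ⟨⟨homOfEquiv e h, homOfEquiv (fun τ => (e τ).symm) (equiv_symm_spec e h), ?_, ?_⟩⟩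
  · exact HOCoalgebra.Hom.ext (TySet.hom_ext fun τ x => (e τ).symm_apply_apply x)
  · exact HOCoalgebra.Hom.ext (TySet.hom_ext fun τ x => (e τ).apply_symm_apply x)

end Unique

/-! ### Bisimilarity is behavioural equivalence -/

/-- The bridge between pushforwards of distributions and the class probabilities in `DistRel`. The
fibre may be infinite, but `w` has finite support. -/
theorem mapDomain_apply_eq_finsum {X Y : Type} (f : X → Y) (w : X →₀ ℝ) (y : Y) :
    Finsupp.mapDomain f w y = ∑ᶠ t ∈ f ⁻¹' {y}, w t := by
  classical
  rw [finsum_mem_def, finsum_eq_sum_of_support_subset (s := w.support)]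
  · simp [Finsupp.mapDomain, Finsupp.sum, Finsupp.finsetSum_apply, Finsupp.single_apply,
      Set.indicator]
  · intro t ht
    simp only [Set.support_indicator, Set.mem_inter_iff] at ht
    simpa using ht.2

theorem distRel_ker {X Y : Type} (f : X → Y) {φ ψ : Dist X} (h : φ.map f = ψ.map f) :
    DistRel (Setoid.ker f) φ ψ := by
  -- The class of `y` under the kernel is the fibre of `f` over `f y`.
  rintro E ⟨y, rfl⟩
  have := DFunLike.congr_fun (congrArg StdSimplex.weights h) (f y)
  rwa [StdSimplex.weights_map, StdSimplex.weights_map, mapDomain_apply_eq_finsum,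
    mapDomain_apply_eq_finsum] at this

theorem DistRel.map_mk_eq {X : Type} {r : Setoid X} {φ ψ : Dist X} (h : DistRel r φ ψ) :
    φ.map (Quotient.mk r) = ψ.map (Quotient.mk r) := by
  ext z
  obtain ⟨y, rfl⟩ := Quotient.exists_rep z
  rw [StdSimplex.weights_map, StdSimplex.weights_map, mapDomain_apply_eq_finsum,
    mapDomain_apply_eq_finsum]
  have hE : Quotient.mk r ⁻¹' {Quotient.mk r y} = {x | r x y} := by
    ext x
    exact Quotient.eq
  rw [hE]
  exact h _ ⟨y, rfl⟩

/-- The kernel of a morphism of coalgebras out of the operational model is a bisimulation. -/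
theorem isBisimulation_ker {N : Endofunctor.Coalgebra (Bp.obj (op Mu))}
    (f : rhoP.opModel.toCoalgebra ⟶ N) : IsBisimulation fun τ => Setoid.ker (f.f τ) := by
  intro τ p q (hpq : f.f τ p = f.f τ q)
  have h : Sum.map (StdSimplex.map (f.f τ)) (Obs.map (𝟙 Mu) f.f τ) (gammaP τ p) =
      Sum.map (StdSimplex.map (f.f τ)) (Obs.map (𝟙 Mu) f.f τ) (gammaP τ q) :=
    (sortStr_hom f τ p).symm.trans ((congrArg (sortStr N τ) hpq).trans (sortStr_hom f τ q))
  generalize gammaP τ p = x at h ⊢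
  generalize gammaP τ q = y at h ⊢
  rcases x with φ | g <;> rcases y with ψ | g'
  · exact .inl (distRel_ker _ (Sum.inl.inj h))
  · cases h
  · cases h
  · refine .inr ?_
    cases τ with
    | unit => trivial
    | arr a b => exact fun t => congrFun (Sum.inr.inj h) t

/-- The sorted set of equivalence classes of programs. -/
abbrev quotSet (R : ∀ τ, Setoid (Mu τ)) : TySet := ⟨fun τ => Quotient (R τ)⟩

def quotMap (R : ∀ τ, Setoid (Mu τ)) : Mu ⟶ quotSet R := fun τ => Quotient.mk (R τ)

/-- This is what lets `γ` descend to classes. Only results are taken modulo `R`: arguments still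
range over programs, so testing functions on equal arguments is enough. -/
theorem IsBisimulation.map_eq {R : ∀ τ, Setoid (Mu τ)} (hR : IsBisimulation R) (τ : Ty) (p q : Mu τ)
    (h : R τ p q) : BMap (𝟙 Mu) (quotMap R) τ (gammaP τ p) =
      BMap (𝟙 Mu) (quotMap R) τ (gammaP τ q) := by
  have h' := hR τ p q h
  generalize gammaP τ p = x at h' ⊢
  generalize gammaP τ q = y at h' ⊢
  cases h' with
  | inl h => exact congrArg Sum.inl h.map_mk_eq
  | inr h =>
    refine congrArg Sum.inr ?_
    cases τ with
    | unit => rfl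
    | arr a b => exact funext fun t => Quotient.sound (h t)

/-- The quotient of the operational model by a bisimulation. -/
noncomputable def quotCoalg {R : ∀ τ, Setoid (Mu τ)} (hR : IsBisimulation R) :
    Endofunctor.Coalgebra (Bp.obj (op Mu)) where
  V := quotSet R
  str := fun τ => Quotient.lift (fun p => BMap (𝟙 Mu) (quotMap R) τ (gammaP τ p)) (hR.map_eq τ)

noncomputable def quotHom {R : ∀ τ, Setoid (Mu τ)} (hR : IsBisimulation R) :
    rhoP.opModel.toCoalgebra ⟶ quotCoalg hR where
  f := quotMap R
  h := rfl

section Beh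

variable {N : Endofunctor.Coalgebra (Bp.obj (op Mu))} (hN : IsTerminal N)

/-- By finality, `beh` factors through the projection onto the quotient by `R`. -/
theorem IsBisimulation.beh_eq {R : ∀ τ, Setoid (Mu τ)} (hR : IsBisimulation R) {τ : Ty}
    {p q : Mu τ} (h : R τ p q) :
    (hN.from rhoP.opModel.toCoalgebra).f τ p = (hN.from rhoP.opModel.toCoalgebra).f τ q := by
  rw [hN.hom_ext (hN.from rhoP.opModel.toCoalgebra) (quotHom hR ≫ hN.from (quotCoalg hR))]
  exact congrArg ((hN.from (quotCoalg hR)).f τ) (Quotient.sound h)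

/-- A greatest bisimulation is exhibited directly, so its equality with the supremum requires no
separate proof that joins of bisimulations are bisimulations. -/
theorem isGreatest_ker_beh :
    IsGreatest {R : ∀ τ, Setoid (Mu τ) | IsBisimulation R}
      fun τ => Setoid.ker ((hN.from rhoP.opModel.toCoalgebra).f τ) :=
  ⟨isBisimulation_ker _, fun _ hR _ _ _ h => IsBisimulation.beh_eq hN hR h⟩

theorem bisimilarity_eq_ker_beh :
    Bisimilarity = fun τ => Setoid.ker ((hN.from rhoP.opModel.toCoalgebra).f τ) :=
  (isGreatest_ker_beh hN).isLUB.sSup_eq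

theorem beh_eq_iff_bisimilarity (τ : Ty) (p q : Mu τ) :
    (hN.from rhoP.opModel.toCoalgebra).f τ p = (hN.from rhoP.opModel.toCoalgebra).f τ q ↔
      Bisimilarity τ p q := by
  rw [bisimilarity_eq_ker_beh hN]
  exact Iff.rfl

end Beh

theorem bisimilarity_isGreatest :
    IsGreatest {R : ∀ τ, Setoid (Mu τ) | IsBisimulation R} Bisimilarity := by
  rw [bisimilarity_eq_ker_beh (nuCoalg_isTerminal Mu)]
  exact isGreatest_ker_beh _

/-! ### Bialgebras -/

/-- The behaviour of an operation applied to elements of `X`, for an algebra `a` and a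
higher-order coalgebra `c` on `X`. -/
noncomputable def stepBeh {X : TySet} (a : SigF.obj X ⟶ X) (c : ∀ τ, X τ → Dist (X τ) ⊕ Obs X X τ) :
    ∀ τ, Sig X τ → Dist (X τ) ⊕ Obs X X τ
  | _, .e => Sum.inr ()
  | _, .app (a := x) (b := y) p q =>
      Sum.elim (fun φ => Sum.inl (φ.map fun p' => a y (Sig.app p' q)))
        (fun f : X x → X y => Sum.inl (StdSimplex.single (f q))) (c (.arr x y) p)
  | _, .s _ _ _ => Sum.inr fun t => a _ (Sig.s1 t)
  | _, .s1 p => Sum.inr fun t => a _ (Sig.s2 p t)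
  | _, .s2 p q => Sum.inr fun t => a _ (Sig.app (a _ (Sig.app p t)) (a _ (Sig.app q t)))
  | _, .k _ b => Sum.inr fun t => a _ (Sig.k1 b t)
  | _, .k1 _ p => Sum.inr fun _ => p
  | _, .i _ => Sum.inr fun t => t
  | _, .choice p q => Sum.inl (StdSimplex.duple p q
      (by norm_num : (0 : ℝ) ≤ 1 / 2) (by norm_num : (0 : ℝ) ≤ 1 / 2) (by norm_num))

theorem interp_eq_stepBeh (P : HOCoalgebra Bp) (a : SigF.obj P.V ⟶ P.V) (τ : Ty) (x : Sig P.V τ) :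
    (SigF.map (pairing (𝟙 P.V) P.str) ≫ rhoP.interp a) τ x = stepBeh a (hoStr P) τ x := by
  cases x with
  | @app c d p q =>
    change BMap (𝟙 P.V) (Free.map (codiag P.V) ≫ Free.hat a) τ
      (rho P.V P.V τ (Sig.app (p, hoStr P (.arr c τ) p) (q, hoStr P c q))) = _
    simp only [stepBeh, rho]
    generalize hoStr P (.arr c τ) p = y
    rcases y with φ | f
    · exact congrArg Sum.inl (StdSimplex.map_map _ _ _)
    · exact congrArg Sum.inl (StdSimplex.map_single _ _)
  | choice p q => exact congrArg Sum.inl (StdSimplex.map_duple _ _ _ _ _ _)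
  | _ => rfl

/-- Turns the bialgebra square into one equation per operator, with the rule's terms already
evaluated in `a`; used both for programs and for the algebra on `Z`. -/
theorem isBialgebra_iff (P : HOCoalgebra Bp) (a : SigF.obj P.V ⟶ P.V) :
    rhoP.IsBialgebra P a ↔ ∀ τ (x : Sig P.V τ), hoStr P τ (a τ x) = stepBeh a (hoStr P) τ x := by
  refine ⟨fun h τ x => ?_, fun h => TySet.hom_ext fun τ x => ?_⟩
  · exact (congrFun (congrFun h τ) x).trans (interp_eq_stepBeh P a τ x)
  · exact (h τ x).trans (interp_eq_stepBeh P a τ x).symm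

theorem gammaP_iota (τ : Ty) (x : Sig Mu τ) :
    gammaP τ (Free.iota _ τ x) = stepBeh (Free.iota _) gammaP τ x :=
  (isBialgebra_iff rhoP.opModel muAlg.str).1 rhoP.opModel_isBialgebra τ x

/-- The initial algebra morphism into a bialgebra is a morphism of higher-order coalgebras. -/
theorem map_den_gammaP {P : HOCoalgebra Bp} {a : SigF.obj P.V ⟶ P.V} (h : rhoP.IsBialgebra P a)
    (τ : Ty) (t : Mu τ) :
    BMap (𝟙 Mu) (den ⟨P.V, a⟩).f τ (gammaP τ t) =
      BMap (den ⟨P.V, a⟩).f (𝟙 P.V) τ (hoStr P τ ((den ⟨P.V, a⟩).f τ t)) := by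
  have hP := (isBialgebra_iff P a).1 h
  -- Both sides satisfy the bialgebra equations, so it suffices to compare the outcomes of the rules
  -- on `x` and on its image.
  have key (τ : Ty) (x : Sig Mu τ)
      (hx : BMap (𝟙 Mu) (den ⟨P.V, a⟩).f τ (stepBeh (Free.iota _) gammaP τ x) =
        BMap (den ⟨P.V, a⟩).f (𝟙 P.V) τ
          (stepBeh a (hoStr P) τ (Sig.map (den ⟨P.V, a⟩).f τ x))) :
      BMap (𝟙 Mu) (den ⟨P.V, a⟩).f τ (gammaP τ (Free.iota _ τ x)) =
        BMap (den ⟨P.V, a⟩).f (𝟙 P.V) τ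
          (hoStr P τ ((den ⟨P.V, a⟩).f τ (Free.iota _ τ x))) := by
    have hd : (den ⟨P.V, a⟩).f τ (Free.iota _ τ x) = a τ (Sig.map (den ⟨P.V, a⟩).f τ x) :=
      congrFun (congrFun (den ⟨P.V, a⟩).h.symm τ) x
    rw [gammaP_iota, hx, hd, hP]
  change Tm _ τ at t
  induction t with
  | var x => exact x.elim
  | e => exact key _ Sig.e rfl
  -- The only rule that inspects the behaviour of an argument, hence the only use of an induction
  -- hypothesis. It forces `p` and `⟦p⟧` to be both reducing or both functions.
  | @app c d p q ihp _ =>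
    refine key _ (Sig.app p q) ?_
    change BMap _ _ d (Sum.elim _ _ (gammaP (.arr c d) p)) =
      BMap _ _ d (Sum.elim _ _ (hoStr P (.arr c d) ((den ⟨P.V, a⟩).f _ p)))
    revert ihp
    generalize gammaP (.arr c d) p = y
    generalize hoStr P (.arr c d) ((den ⟨P.V, a⟩).f _ p) = y'
    intro ihp
    rcases y with φ | f <;> rcases y' with φ' | f'
    · have hφ : φ.map ((den ⟨P.V, a⟩).f (.arr c d)) = φ' :=
        (Sum.inl.inj ihp).trans (StdSimplex.map_id φ')
      subst hφ
      refine congrArg Sum.inl ?_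
      change StdSimplex.map _ (StdSimplex.map _ φ) =
        StdSimplex.map id (StdSimplex.map _ (StdSimplex.map _ φ))
      rw [StdSimplex.map_id]
      refine (StdSimplex.map_map φ _ _).trans (Eq.trans ?_ (StdSimplex.map_map φ _ _).symm)
      rfl
    · cases ihp
    · cases ihp
    · have hf : (den ⟨P.V, a⟩).f d (f q) = f' ((den ⟨P.V, a⟩).f c q) :=
        congrFun (Sum.inr.inj ihp) q
      refine congrArg Sum.inl ((StdSimplex.map_single _ _).trans ?_)
      rw [hf]
      exact (StdSimplex.map_id _).symm
  | s x y z => exact key _ (Sig.s x y z) rfl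
  | s1 p _ => exact key _ (Sig.s1 p) rfl
  | s2 p q _ _ => exact key _ (Sig.s2 p q) rfl
  | k x y => exact key _ (Sig.k x y) rfl
  | k1 y p _ => exact key _ (Sig.k1 y p) rfl
  | i x => exact key _ (Sig.i x) rfl
  | choice p q _ _ =>
    refine key _ (Sig.choice p q) (congrArg Sum.inl ?_)
    exact (StdSimplex.map_duple _ _ _ _ _ _).trans (StdSimplex.map_id _).symm

/-- A bialgebra `P` as a coalgebra of `B(μΣ, -)`. -/
noncomputable def restrictCoalg (P : HOCoalgebra Bp) (a : SigF.obj P.V ⟶ P.V) :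
    Endofunctor.Coalgebra (Bp.obj (op Mu)) where
  V := P.V
  str := P.str ≫ (Bp.map (den ⟨P.V, a⟩).f.op).app P.V

noncomputable def denHom {P : HOCoalgebra Bp} {a : SigF.obj P.V ⟶ P.V}
    (h : rhoP.IsBialgebra P a) : rhoP.opModel.toCoalgebra ⟶ restrictCoalg P a where
  f := (den ⟨P.V, a⟩).f
  h := TySet.hom_ext (map_den_gammaP h)

/-- Both sides are morphisms from the operational model into the final coalgebra. -/
theorem den_comp_from {P : HOCoalgebra Bp} {a : SigF.obj P.V ⟶ P.V} (h : rhoP.IsBialgebra P a)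
    {N : Endofunctor.Coalgebra (Bp.obj (op Mu))} (hN : IsTerminal N) :
    (den ⟨P.V, a⟩).f ≫ (hN.from (restrictCoalg P a)).f =
      (hN.from rhoP.opModel.toCoalgebra).f :=
  congrArg Endofunctor.Coalgebra.Hom.f (hN.hom_ext (denHom h ≫ hN.from _) (hN.from _))

/-- Every bialgebra is adequate. -/
theorem isAdequate_of_isBialgebra {P : HOCoalgebra Bp} {a : SigF.obj P.V ⟶ P.V}
    (h : rhoP.IsBialgebra P a) : rhoP.IsAdequate ⟨P.V, a⟩ :=
  ⟨⟨nuCoalg Mu, ⟨nuCoalg_isTerminal Mu⟩⟩, fun _ hN => ⟨_, den_comp_from h hN⟩⟩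

theorem bisimilarity_of_den_eq {P : HOCoalgebra Bp} {a : SigF.obj P.V ⟶ P.V}
    (h : rhoP.IsBialgebra P a) (τ : Ty) (p q : Mu τ)
    (hpq : (den ⟨P.V, a⟩).f τ p = (den ⟨P.V, a⟩).f τ q) : Bisimilarity τ p q := by
  rw [← beh_eq_iff_bisimilarity (nuCoalg_isTerminal Mu), ← den_comp_from h]
  exact congrArg ((nuCoalg_isTerminal Mu |>.from (restrictCoalg P a)).f τ) hpq

/-! ### The algebra structure on a locally final coalgebra -/

section DenotationalAlgebra

variable {Z : HOCoalgebra Bp} (hZ : ∀ τ, IsFinalDist (hoStr Z τ))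

/-- Application is defined by corecursion. -/
theorem exists_zapp (a b : Ty) (hZ : IsFinalDist (hoStr Z b)) (q : Z.V a) :
    ∃ f : Z.V (.arr a b) → Z.V b, ∀ p, hoStr Z b (f p) =
      Sum.elim (fun φ => Sum.inl (φ.map f))
        (fun g : Z.V a → Z.V b => Sum.inl (StdSimplex.single (g q))) (hoStr Z (.arr a b) p) := by
  -- The left summand holds pending applications to `q`. The right summand holds finished elements
  -- of `Z`: once `p` is a function `g`, the successor is `g q` itself. By `hr`, the corecursive map
  -- is the identity there.
  obtain ⟨f, hf, -⟩ := hZ (Z.V (.arr a b) ⊕ Z.V b) (Sum.elim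
    (fun p => Sum.elim (fun φ => Sum.inl (φ.map Sum.inl))
      (fun g : Z.V a → Z.V b => Sum.inl (StdSimplex.single (Sum.inr (g q))))
      (hoStr Z (.arr a b) p))
    (fun y => Sum.map (StdSimplex.map Sum.inr) id (hoStr Z b y)))
  have hr : f ∘ Sum.inr = id := by
    refine hZ.hom_ext (hoStr Z b) (fun y => ?_) fun y => (sumMap_dist_id _).symm
    exact (hf (Sum.inr y)).trans (sumMap_dist_comp _ _ _ _ _)
  refine ⟨f ∘ Sum.inl, fun p => (hf (Sum.inl p)).trans ?_⟩
  rw [Sum.elim_inl]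
  generalize hoStr Z (.arr a b) p = y
  rcases y with φ | g
  · exact congrArg Sum.inl (StdSimplex.map_map φ _ _)
  · refine congrArg Sum.inl ((StdSimplex.map_single _ _).trans ?_)
    exact congrArg StdSimplex.single (congrFun hr (g q))

noncomputable def zapp {a b : Ty} (p : Z.V (.arr a b)) (q : Z.V a) : Z.V b :=
  (exists_zapp a b (hZ b) q).choose p

/-- The element with a given behaviour. -/
noncomputable def zmk {τ : Ty} (x : Dist (Z.V τ) ⊕ Obs Z.V Z.V τ) : Z.V τ :=
  ((hZ τ).bijective.surjective x).choose

theorem hoStr_zmk {τ : Ty} (x : Dist (Z.V τ) ⊕ Obs Z.V Z.V τ) : hoStr Z τ (zmk hZ x) = x :=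
  ((hZ τ).bijective.surjective x).choose_spec

/-- The order matters: the rule of `S''` uses application, that of `S'` uses `S''`, that of `S` uses
`S'`, and that of `K` uses `K'`. So each behaviour is known before its operator is defined. -/
noncomputable def zs2 {a b c : Ty} (p : Z.V (.arr a (.arr b c))) (q : Z.V (.arr a b)) :
    Z.V (.arr a c) :=
  zmk hZ (Sum.inr fun t => zapp hZ (zapp hZ p t) (zapp hZ q t))

noncomputable def zs1 {a b c : Ty} (p : Z.V (.arr a (.arr b c))) :
    Z.V (.arr (.arr a b) (.arr a c)) :=
  zmk hZ (Sum.inr fun t => zs2 hZ p t)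

noncomputable def zk1 {a : Ty} (b : Ty) (p : Z.V a) : Z.V (.arr b a) :=
  zmk hZ (Sum.inr fun _ => p)

/-- The `Σ`-algebra structure on a locally final coalgebra. -/
noncomputable def zalg : SigF.obj Z.V ⟶ Z.V
  | _, .e => zmk hZ (τ := .unit) (Sum.inr ())
  | _, .app p q => zapp hZ p q
  | _, .s a b c => zmk hZ (τ := .arr (.arr a (.arr b c)) (.arr (.arr a b) (.arr a c)))
      (Sum.inr fun t => zs1 hZ t)
  | _, .s1 p => zs1 hZ p
  | _, .s2 p q => zs2 hZ p q
  | _, .k a b => zmk hZ (τ := .arr a (.arr b a)) (Sum.inr fun t => zk1 hZ b t)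
  | _, .k1 b p => zk1 hZ b p
  | _, .i a => zmk hZ (τ := .arr a a) (Sum.inr fun t => t)
  | _, .choice p q => zmk hZ (Sum.inl (StdSimplex.duple p q
      (by norm_num : (0 : ℝ) ≤ 1 / 2) (by norm_num : (0 : ℝ) ≤ 1 / 2) (by norm_num)))

theorem zalg_isBialgebra : rhoP.IsBialgebra Z (zalg hZ) := by
  refine (isBialgebra_iff Z _).2 fun τ x => ?_
  cases x with
  | @app a b p q => exact (exists_zapp a τ (hZ τ) q).choose_spec p
  | _ => exact hoStr_zmk hZ _

end DenotationalAlgebra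

end XPTCL

open XPTCL
theorem mainTheorem7 :
    (∃ Z : HOCoalgebra Bp, Z.IsLocallyFinal) ∧
    (∀ Z Z' : HOCoalgebra Bp, Z.IsLocallyFinal → Z'.IsLocallyFinal → Nonempty (Z ≅ Z')) ∧
    IsGreatest {R : ∀ τ, Setoid (Mu τ) | IsBisimulation R} Bisimilarity ∧
    (∀ (N : Endofunctor.Coalgebra (Bp.obj (op Mu))) (hN : IsTerminal N) (τ : Ty) (p q : Mu τ),
      (hN.from rhoP.opModel.toCoalgebra).f τ p = (hN.from rhoP.opModel.toCoalgebra).f τ q ↔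
        Bisimilarity τ p q) ∧
    ∀ Z : HOCoalgebra Bp, Z.IsLocallyFinal →
      ∃ a : SigF.obj Z.V ⟶ Z.V,
        rhoP.IsDenotationalModel Z a ∧
        rhoP.IsAdequate ⟨Z.V, a⟩ ∧
        ∀ (τ : Ty) (p q : Mu τ),
          (den ⟨Z.V, a⟩).f τ p = (den ⟨Z.V, a⟩).f τ q → Bisimilarity τ p q := by
  refine ⟨⟨locCoalg, locCoalg_isLocallyFinal⟩,
    fun _ _ hZ hZ' => HOCoalgebra.IsLocallyFinal.nonempty_iso hZ hZ', bisimilarity_isGreatest,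
    fun _ hN => beh_eq_iff_bisimilarity hN, fun Z hZ => ?_⟩
  have h := zalg_isBialgebra (HOCoalgebra.IsLocallyFinal.sortwise hZ)
  exact ⟨_, ⟨hZ, h⟩, isAdequate_of_isBialgebra h, bisimilarity_of_den_eq h⟩
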